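/- Let $\mathbf{k}$ be a field of any characteristic, let $n\ge 1$, and let $1\le a_1<\cdots<a_n$ be integers with $\gcd(a_1,\dots,a_n)=1$; put $\omega=(a_1,\dots,a_n)$ and $\deg_\omega K=\sum_{i=1}^n k_i a_i$ for $K=(k_1,\dots,k_n)\in\mathbb N^n$. Let $R=\mathbf{k}[\![x_1,\dots,x_n]\!]$ and let $\Gamma=\mathbf{k}_{DP}[y_1,\dots,y_n]$ be the divided power ring, that is, the $\mathbf{k}$-vector space with basis the monomials $y^K$, $K\in\mathbb N^n$, viewed as an $R$-module by contraction: $x^\alpha\circ y^\beta=y^{\beta-\alpha}$ if $\beta_i\ge\alpha_i$ for all $i$, and $x^\alpha\circ y^\beta=0$ otherwise (extended to all power series; for a given element of $\Gamma$ only finitely many terms of the series contribute). For an ideal $I\subseteq R$ let $I^\perp=\{F\in\Gamma \mid g\circ F=0 \text{ for all } g\in I\}$, an $R$-submodule of $\Gamma$. Let $I(a_1,\dots,a_n)$ be the kernel of the $\mathbf{k}$-algebra homomorphism $R\to\mathbf{k}[\![t]\!]$ given by the substitution $x_i\mapsto t^{a_i}$. Let $\mathcal J=\{\deg_\omega K \mid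 K\in\mathbb N^n\}$, and for $j\in\mathcal J$ let $$L_{\omega,j}=\sum_{K\in\mathbb N^n,\ \deg_\omega K=j} y^K\in\Gamma .$$ Then $$I(a_1,\dots,a_n)^\perp=\bigcup_{j\in\mathcal J}\langle L_{\omega,j}\rangle ,$$ where $\langle L_{\omega,j}\rangle$ is the $R$-submodule of $\Gamma$ generated by $L_{\omega,j}$. Moreover, $I(a_1,\dots,a_n)^\perp$ is an almost finitely generated $R$-module, i.e. it is not finitely generated, but each of its proper $R$-submodules is finitely generated. -/

import Mathlib

noncomputable section

namespace SemigroupInverseSystem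

/-- The underlying space of the divided power ring `Γ = k_DP[y_1, …, y_n]`: the `k`-vector space
with basis the (divided) monomials `y^K`, `K ∈ ℕⁿ`. Only its module structure over
`k⟦x_1, …, x_n⟧` by contraction is needed here, not its multiplication. -/
def Gam (k : Type*) [Field k] (n : ℕ) : Type _ := (Fin n →₀ ℕ) →₀ k

variable {k : Type*} [Field k] {n : ℕ}

instance : AddCommGroup (Gam k n) := inferInstanceAs (AddCommGroup ((Fin n →₀ ℕ) →₀ k))

instance : Module k (Gam k n) := inferInstanceAs (Module k ((Fin n →₀ ℕ) →₀ k))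

/-- The scalar multiple `c y^K` of the basis monomial `y^K` of `Γ`, as an additive map in `c`. -/
def mon (K : Fin n →₀ ℕ) : k →+ Gam k n := Finsupp.singleAddHom K

theorem gam_hom_ext {M : Type*} [AddZeroClass M] {f g : Gam k n →+ M}
    (h : ∀ K c, f (mon K c) = g (mon K c)) : f = g :=
  Finsupp.addHom_ext h

/-- Contraction by a power series `f = ∑ f_α x^α`. It is additive with
`f ∘ (c y^β) = ∑_{α + γ = β} (f_α c) y^γ`, a finite sum; equivalently
`x^α ∘ y^β = y^(β - α)` if `α ≤ β` and `0` otherwise, extended linearly. -/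
def contract (f : MvPowerSeries (Fin n) k) : Gam k n →+ Gam k n :=
  Finsupp.liftAddHom fun β : Fin n →₀ ℕ =>
    ∑ p ∈ Finset.HasAntidiagonal.antidiagonal β,
      (mon p.2).comp (AddMonoidHom.mulLeft (MvPowerSeries.coeff p.1 f))

theorem contract_mon (f : MvPowerSeries (Fin n) k) (β : Fin n →₀ ℕ) (c : k) :
    contract f (mon β c) =
      ∑ p ∈ Finset.HasAntidiagonal.antidiagonal β, mon p.2 (MvPowerSeries.coeff p.1 f * c) := by
  refine (Finsupp.liftAddHom_apply_single _ _ _).trans ?_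
  simp [AddMonoidHom.finsetSum_apply]

theorem contract_one : contract (1 : MvPowerSeries (Fin n) k) = AddMonoidHom.id _ := by
  classical
  apply gam_hom_ext
  intro β c
  rw [contract_mon, Finset.sum_eq_single ((0 : Fin n →₀ ℕ), β)]
  · simp
  · rintro ⟨u, v⟩ huv hne
    have hu : u ≠ 0 := by
      rintro rfl
      simp only [Finset.HasAntidiagonal.mem_antidiagonal, zero_add] at huv
      exact hne (by rw [huv])
    simp [MvPowerSeries.coeff_one, hu]
  · simp

theorem contract_mul (f g : MvPowerSeries (Fin n) k) :
    contract (f * g) = (contract f).comp (contract g) := by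
  classical
  apply gam_hom_ext
  intro β c
  simp only [AddMonoidHom.comp_apply, contract_mon, map_sum, MvPowerSeries.coeff_mul,
    Finset.sum_mul, Finset.sum_sigma']
  refine Finset.sum_nbij' (fun ⟨⟨_, j⟩, ⟨u, v⟩⟩ => ⟨(v, u + j), (u, j)⟩)
    (fun ⟨⟨v, _⟩, ⟨u, j⟩⟩ => ⟨(u + v, j), (u, v)⟩) ?_ ?_ ?_ ?_ ?_ <;>
    simp only [Finset.mem_sigma, Finset.HasAntidiagonal.mem_antidiagonal, Sigma.forall, Prod.forall]
  · rintro i j u v ⟨rfl, rfl⟩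
    exact ⟨by abel, trivial⟩
  · rintro v w u j ⟨rfl, rfl⟩
    exact ⟨by abel, trivial⟩
  · rintro i j u v ⟨rfl, rfl⟩
    rfl
  · rintro v w u j ⟨rfl, rfl⟩
    rfl
  · rintro i j u v ⟨rfl, rfl⟩
    rw [mul_assoc]

/-- `Γ` is a module over `R = k⟦x_1, …, x_n⟧` by contraction. -/
instance : Module (MvPowerSeries (Fin n) k) (Gam k n) where
  smul f F := contract f F
  one_smul F := DFunLike.congr_fun contract_one F
  mul_smul f g F := DFunLike.congr_fun (contract_mul f g) F
  smul_zero f := map_zero (contract f)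
  smul_add f F G := map_add (contract f) F G
  add_smul f g F := by
    have h : contract (f + g) = contract f + contract g := by
      apply gam_hom_ext
      intro β c
      simp [contract_mon, add_mul, Finset.sum_add_distrib]
    exact DFunLike.congr_fun h F
  zero_smul F := by
    have h : contract (0 : MvPowerSeries (Fin n) k) = 0 := by
      apply gam_hom_ext
      intro β c
      simp [contract_mon]
    exact DFunLike.congr_fun h F

theorem smul_mon (f : MvPowerSeries (Fin n) k) (β : Fin n →₀ ℕ) (c : k) :
    f • (mon β c : Gam k n) =
      ∑ p ∈ Finset.HasAntidiagonal.antidiagonal β, mon p.2 (MvPowerSeries.coeff p.1 f * c) :=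
  contract_mon f β c

/-- The contraction rule on monomials. -/
theorem monomial_smul_mon (α β : Fin n →₀ ℕ) :
    (MvPowerSeries.monomial α (1 : k)) • (mon β 1 : Gam k n) =
      if α ≤ β then mon (β - α) 1 else 0 := by
  classical
  rw [smul_mon]
  split_ifs with h
  · rw [Finset.sum_eq_single (α, β - α)]
    · simp
    · rintro ⟨u, v⟩ huv hne
      have hu : u ≠ α := by
        rintro rfl
        rw [Finset.HasAntidiagonal.mem_antidiagonal] at huv
        simp only at huv
        exact hne (by rw [← huv, add_tsub_cancel_left])
      simp [MvPowerSeries.coeff_monomial, hu]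
    · intro hne
      exact absurd (by simpa using add_tsub_cancel_of_le h) hne
  · refine Finset.sum_eq_zero ?_
    rintro ⟨u, v⟩ huv
    have hu : u ≠ α := by
      rintro rfl
      rw [Finset.HasAntidiagonal.mem_antidiagonal] at huv
      exact h (huv ▸ le_self_add)
    simp [MvPowerSeries.coeff_monomial, hu]

/-- The inverse system `I^⊥ = {F ∈ Γ | g ∘ F = 0 for all g ∈ I}`, an `R`-submodule of `Γ`. -/
def inverseSystem (I : Ideal (MvPowerSeries (Fin n) k)) :
    Submodule (MvPowerSeries (Fin n) k) (Gam k n) where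
  carrier := {F | ∀ g ∈ I, g • F = 0}
  add_mem' hF hG g hg := by rw [smul_add, hF g hg, hG g hg, add_zero]
  zero_mem' g _ := smul_zero g
  smul_mem' r F hF g hg := by rw [smul_comm, hF g hg, smul_zero]

theorem hasSubst_pow (k : Type*) [Field k] (a : Fin n → ℕ) (ha : ∀ i, 1 ≤ a i) :
    MvPowerSeries.HasSubst (fun i => (PowerSeries.X : PowerSeries k) ^ a i) := by
  apply MvPowerSeries.hasSubst_of_constantCoeff_zero
  intro i
  have h : PowerSeries.constantCoeff ((PowerSeries.X : PowerSeries k) ^ a i) = 0 := by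
    simp [show a i ≠ 0 from Nat.one_le_iff_ne_zero.mp (ha i)]
  exact h

/-- The parametrization `φ : k⟦x_1, …, x_n⟧ → k⟦t⟧` of the monomial curve, `x_i ↦ t^{a_i}`
(substitution of power series). -/
def curveMap (k : Type*) [Field k] (a : Fin n → ℕ) (ha : ∀ i, 1 ≤ a i) :
    MvPowerSeries (Fin n) k →ₐ[k] PowerSeries k :=
  MvPowerSeries.substAlgHom (hasSubst_pow k a ha)

/-- The ideal `I(a_1, …, a_n) = ker φ`. -/
def semigroupIdeal (k : Type*) [Field k] (a : Fin n → ℕ) (ha : ∀ i, 1 ≤ a i) :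
    Ideal (MvPowerSeries (Fin n) k) :=
  RingHom.ker (curveMap k a ha)

/-- The weighted degree `deg_ω K = ∑ i, K_i a_i` for `ω = a`. -/
def wdeg (a : Fin n → ℕ) (K : Fin n →₀ ℕ) : ℕ := ∑ i, K i * a i

theorem finite_wdeg_eq (a : Fin n → ℕ) (ha : ∀ i, 1 ≤ a i) (j : ℕ) :
    {K : Fin n →₀ ℕ | wdeg a K = j}.Finite := by
  have h := Finsupp.finite_of_nat_weight_eq a (fun i => Nat.one_le_iff_ne_zero.mp (ha i)) j
  refine h.subset ?_
  intro K hK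
  simpa [wdeg, Finsupp.weight_apply, Finsupp.sum_fintype] using hK

/-- The set `𝒥` of degrees `j = deg_ω K`, `K ∈ ℕⁿ` (the numerical semigroup). -/
def degrees (a : Fin n → ℕ) : Set ℕ := {j | ∃ K : Fin n →₀ ℕ, wdeg a K = j}

/-- The form `L_{ω,j} = ∑_{deg_ω K = j} y^K`. -/
def formL (k : Type*) [Field k] (a : Fin n → ℕ) (ha : ∀ i, 1 ≤ a i) (j : ℕ) : Gam k n :=
  ∑ K ∈ (finite_wdeg_eq a ha j).toFinset, mon K 1

/-- A module is almost finitely generated if it is not finitely generated, but all its proper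
submodules are. -/
def AlmostFG (R M : Type*) [CommRing R] [AddCommGroup M] [Module R M] : Prop :=
  ¬ Module.Finite R M ∧ ∀ N : Submodule R M, N ≠ ⊤ → N.FG

end SemigroupInverseSystem

end

noncomputable section

namespace SemigroupInverseSystem

open Finset Filter

variable {k : Type*} [Field k] {n : ℕ}

/-! The ring `R` acts on the forms `L_j` through its image in `k⟦t⟧`, with `t^i` lowering `L_d` to
`L_{d-i}`; `curveForm u d` is "`u` applied to `L_d`" for any `u` in `k⟦t⟧`. Binomials in the ideal
force every `F` in the inverse system to be such a form (`exists_eq_curveForm`). The pair `(u, d)`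
may be replaced by `(u t^i, d + i)`, and the image of `R` contains all series of order at least the
conductor `c`. Hence `F` is a multiple of every `L_D` with `D ≥ d + c` (`curveForm_eq_smul_formL`),
and if `u` is a unit, `F` generates every `L_l` with `l + c ≤ d` (`formL_eq_smul_curveForm`). The
first fact gives the union and excludes finite generation; the second bounds the degrees in a proper
submodule. -/

/-! ### Coefficients and scalars in `Γ`. -/

/-- The coefficient of `y^γ` in an element of `Γ`. -/
def gamCoeff (γ : Fin n →₀ ℕ) : Gam k n →+ k :=
  Finsupp.applyAddHom γ

theorem gamCoeff_ext {F G : Gam k n} (h : ∀ γ, gamCoeff γ F = gamCoeff γ G) : F = G :=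
  Finsupp.ext h

theorem gamCoeff_mon (γ β : Fin n →₀ ℕ) (c : k) :
    gamCoeff γ (mon β c) = if β = γ then c else 0 := by
  classical
  exact Finsupp.single_apply

theorem finite_setOf_gamCoeff_ne_zero (F : Gam k n) : {γ | gamCoeff γ F ≠ 0}.Finite :=
  F.hasFiniteSupport

theorem gamCoeff_smul_mon (f : MvPowerSeries (Fin n) k) (γ β : Fin n →₀ ℕ) (c : k) :
    gamCoeff γ (f • (mon β c : Gam k n)) =
      if γ ≤ β then MvPowerSeries.coeff (β - γ) f * c else 0 := by
  classical
  simp only [smul_mon, map_sum, gamCoeff_mon]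
  split_ifs with h
  · rw [Finset.sum_eq_single (β - γ, γ)]
    · simp
    · rintro ⟨u, v⟩ huv hne
      rw [Finset.HasAntidiagonal.mem_antidiagonal] at huv
      refine if_neg ?_
      rintro rfl
      exact hne (by rw [← huv]; simp)
    · intro hne
      exact absurd (by simpa using tsub_add_cancel_of_le h) hne
  · refine Finset.sum_eq_zero ?_
    rintro ⟨u, v⟩ huv
    rw [Finset.HasAntidiagonal.mem_antidiagonal] at huv
    refine if_neg ?_
    rintro rfl
    exact h (huv ▸ le_add_self)

/-- Turns annihilation by a power series into linear relations between coefficients. -/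
theorem gamCoeff_zero_monomial_smul (α : Fin n →₀ ℕ) (F : Gam k n) :
    gamCoeff 0 (MvPowerSeries.monomial α (1 : k) • F) = gamCoeff α F := by
  classical
  have h : (gamCoeff 0).comp (contract (MvPowerSeries.monomial α (1 : k))) =
      (gamCoeff α : Gam k n →+ k) := by
    apply gam_hom_ext
    intro β c
    refine (gamCoeff_smul_mon _ 0 β c).trans ?_
    simp [gamCoeff_mon, MvPowerSeries.coeff_monomial]
  exact DFunLike.congr_fun h F

theorem C_smul_mon (c d : k) (β : Fin n →₀ ℕ) :
    (MvPowerSeries.C c : MvPowerSeries (Fin n) k) • (mon β d : Gam k n) = mon β (c * d) := by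
  classical
  apply gamCoeff_ext
  intro γ
  rw [gamCoeff_smul_mon, gamCoeff_mon, MvPowerSeries.coeff_C]
  by_cases h : β = γ
  · simp [h]
  · by_cases h' : γ ≤ β
    · have : β - γ ≠ 0 := fun h0 => h (le_antisymm (tsub_eq_zero_iff_le.mp h0) h')
      simp [h, this]
    · simp [h, h']

theorem C_smul (c : k) (F : Gam k n) :
    (MvPowerSeries.C c : MvPowerSeries (Fin n) k) • F = c • F := by
  have h : contract (MvPowerSeries.C c : MvPowerSeries (Fin n) k) =
      DistribSMul.toAddMonoidHom (Gam k n) c := by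
    apply gam_hom_ext
    intro β d
    refine (C_smul_mon c d β).trans ?_
    exact (Finsupp.smul_single c β d).symm
  exact DFunLike.congr_fun h F

instance : IsScalarTower k (MvPowerSeries (Fin n) k) (Gam k n) where
  smul_assoc c f F := by
    rw [← C_smul c (f • F), MvPowerSeries.smul_eq_C_mul, mul_smul]

theorem gamCoeff_smul (c : k) (γ : Fin n →₀ ℕ) (F : Gam k n) :
    gamCoeff γ (c • F) = c * gamCoeff γ F :=
  rfl

/-! ### The numerical semigroup and the image of the parametrization. -/

theorem wdeg_add (a : Fin n → ℕ) (K L : Fin n →₀ ℕ) : wdeg a (K + L) = wdeg a K + wdeg a L := by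
  simp [wdeg, add_mul, Finset.sum_add_distrib]

/-- The conductor: every large enough integer is a degree. -/
theorem eventually_mem_degrees (a : Fin n → ℕ) (hgcd : Finset.univ.gcd a = 1) :
    ∃ c, ∀ m, c ≤ m → m ∈ degrees a := by
  obtain ⟨c, hc⟩ := Nat.exists_mem_closure_of_ge (Set.range a)
  have h1 : Nat.setGcd (Set.range a) = 1 := by
    rw [← Nat.dvd_one, ← hgcd]
    exact Finset.dvd_gcd fun i _ => Nat.setGcd_dvd_of_mem ⟨i, rfl⟩
  refine ⟨c, fun m hm => ?_⟩
  have hmem := hc m hm (by simp [h1])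
  clear hm
  induction hmem using AddSubmonoid.closure_induction with
  | mem x hx =>
    obtain ⟨i, rfl⟩ := hx
    refine ⟨Finsupp.single i 1, ?_⟩
    rw [wdeg, Finset.sum_eq_single i] <;> simp +contextual [eq_comm]
  | zero => exact ⟨0, by simp [wdeg]⟩
  | add x y _ _ hx hy =>
    obtain ⟨K, rfl⟩ := hx
    obtain ⟨L, rfl⟩ := hy
    exact ⟨K + L, wdeg_add a K L⟩

variable (a : Fin n → ℕ) (ha : ∀ i, 1 ≤ a i)

theorem coeff_curveMap (f : MvPowerSeries (Fin n) k) (m : ℕ) :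
    PowerSeries.coeff m (curveMap k a ha f) =
      ∑ K ∈ (finite_wdeg_eq a ha m).toFinset, MvPowerSeries.coeff K f := by
  have hprod (K : Fin n →₀ ℕ) :
      (K.prod fun i e => ((PowerSeries.X : PowerSeries k) ^ a i) ^ e) =
        PowerSeries.X ^ wdeg a K := by
    rw [Finsupp.prod_fintype _ _ (by simp), wdeg, ← Finset.prod_pow_eq_pow_sum]
    exact Finset.prod_congr rfl fun i _ => by rw [← pow_mul, mul_comm]
  have h := MvPowerSeries.coeff_subst (hasSubst_pow k a ha) f (Finsupp.single () m)
  rw [← MvPowerSeries.substAlgHom_apply (hasSubst_pow k a ha)] at h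
  refine h.trans ?_
  have hc (K : Fin n →₀ ℕ) : MvPowerSeries.coeff (Finsupp.single () m)
      (K.prod fun i e => ((PowerSeries.X : PowerSeries k) ^ a i) ^ e) =
        if m = wdeg a K then 1 else 0 := by
    rw [hprod]
    exact PowerSeries.coeff_X_pow m (wdeg a K)
  simp only [hc]
  rw [finsum_eq_sum_of_support_subset (s := (finite_wdeg_eq a ha m).toFinset)]
  · refine Finset.sum_congr rfl fun K hK => ?_
    have hK' : wdeg a K = m := by simpa using hK
    simp [hK']
  · intro K hK
    by_contra hne
    have hne' : ¬ wdeg a K = m := by simpa using hne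
    simp [Ne.symm hne'] at hK

/-- A power series whose exponents are all degrees is in the image of the parametrization. -/
theorem exists_curveMap_eq (h : PowerSeries k)
    (hh : ∀ m, m ∉ degrees a → PowerSeries.coeff m h = 0) : ∃ f, curveMap k a ha f = h := by
  classical
  have hσ (m : ℕ) : ∃ K : Fin n →₀ ℕ, m ∈ degrees a → wdeg a K = m := by
    by_cases hm : m ∈ degrees a
    · exact hm.imp fun K hK _ => hK
    · exact ⟨0, fun h => absurd h hm⟩
  choose σ hσ using hσ
  -- One monomial `σ m` per degree carries the whole coefficient of `t^m`.
  let f : MvPowerSeries (Fin n) k :=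
    fun K => if K = σ (wdeg a K) then PowerSeries.coeff (wdeg a K) h else 0
  have hf (K) : MvPowerSeries.coeff K f =
    if K = σ (wdeg a K) then PowerSeries.coeff (wdeg a K) h else 0 := rfl
  refine ⟨f, PowerSeries.ext fun m => ?_⟩
  rw [coeff_curveMap]
  have h1 : ∀ K ∈ (finite_wdeg_eq a ha m).toFinset, MvPowerSeries.coeff K f =
      if K = σ m then PowerSeries.coeff m h else 0 := by
    intro K hK
    have hK' : wdeg a K = m := by simpa using hK
    rw [hf, hK']
  rw [Finset.sum_congr rfl h1, Finset.sum_ite_eq']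
  split_ifs with hm
  · rfl
  · refine (hh m fun hd => hm ?_).symm
    simpa using hσ m hd

/-! ### Contraction of the forms through `k⟦t⟧`. -/

theorem gamCoeff_formL (j : ℕ) (γ : Fin n →₀ ℕ) :
    gamCoeff γ (formL k a ha j) = if wdeg a γ = j then 1 else 0 := by
  classical
  simp [formL, map_sum, gamCoeff_mon]

/-- Subtracting `γ` maps the exponents `K ≥ γ` of degree `j` bijectively onto those of degree `j -
wdeg a γ`. -/
theorem gamCoeff_smul_formL (f : MvPowerSeries (Fin n) k) (j : ℕ) (γ : Fin n →₀ ℕ) :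
    gamCoeff γ (f • formL k a ha j) =
      if wdeg a γ ≤ j then PowerSeries.coeff (j - wdeg a γ) (curveMap k a ha f) else 0 := by
  classical
  simp only [formL, Finset.smul_sum, map_sum, gamCoeff_smul_mon, mul_one]
  rw [← Finset.sum_filter]
  split_ifs with h
  · rw [coeff_curveMap]
    refine Finset.sum_nbij' (· - γ) (· + γ) ?_ ?_ ?_ ?_ ?_
    · intro K hK
      simp only [Finset.mem_filter, Set.Finite.mem_toFinset, Set.mem_ofPred] at hK ⊢
      have := wdeg_add a (K - γ) γ
      rw [tsub_add_cancel_of_le hK.2] at this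
      omega
    · intro K hK
      simp only [Finset.mem_filter, Set.Finite.mem_toFinset, Set.mem_ofPred] at hK ⊢
      exact ⟨by rw [wdeg_add]; omega, le_add_self⟩
    · intro K hK
      exact tsub_add_cancel_of_le (Finset.mem_filter.mp hK).2
    · intro K _
      exact add_tsub_cancel_right K γ
    · intro K _
      rfl
  · refine Finset.sum_eq_zero fun K hK => ?_
    simp only [Finset.mem_filter, Set.Finite.mem_toFinset, Set.mem_ofPred] at hK
    have := wdeg_add a (K - γ) γ
    rw [tsub_add_cancel_of_le hK.2] at this
    omega

/-- The element `∑_{p + q = d} u_p L_{ω,q}` of `Γ`: the contraction of `L_{ω,d}` by a power series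
`u` in the parameter `t` of the curve. -/
def curveForm (u : PowerSeries k) (d : ℕ) : Gam k n :=
  ∑ p ∈ antidiagonal d, PowerSeries.coeff p.1 u • formL k a ha p.2

theorem gamCoeff_curveForm (u : PowerSeries k) (d : ℕ) (γ : Fin n →₀ ℕ) :
    gamCoeff γ (curveForm a ha u d) =
      if wdeg a γ ≤ d then PowerSeries.coeff (d - wdeg a γ) u else 0 := by
  simp only [curveForm, map_sum, gamCoeff_smul, gamCoeff_formL, mul_ite, mul_one, mul_zero]
  split_ifs with h
  · rw [Finset.sum_eq_single (d - wdeg a γ, wdeg a γ)]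
    · simp
    · rintro ⟨p, q⟩ hpq hne
      rw [HasAntidiagonal.mem_antidiagonal] at hpq
      refine if_neg ?_
      rintro rfl
      exact hne (by rw [← hpq]; simp)
    · intro hne
      exact absurd (by simpa using tsub_add_cancel_of_le h) hne
  · refine Finset.sum_eq_zero ?_
    rintro ⟨p, q⟩ hpq
    rw [HasAntidiagonal.mem_antidiagonal] at hpq
    refine if_neg ?_
    dsimp only at *
    omega

theorem smul_formL (f : MvPowerSeries (Fin n) k) (d : ℕ) :
    f • formL k a ha d = curveForm a ha (curveMap k a ha f) d :=
  gamCoeff_ext fun γ => by rw [gamCoeff_smul_formL, gamCoeff_curveForm]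

theorem smul_curveForm (f : MvPowerSeries (Fin n) k) (u : PowerSeries k) (d : ℕ) :
    f • curveForm a ha u d = curveForm a ha (u * curveMap k a ha f) d := by
  have h (c : k) (F : Gam k n) : f • c • F = c • f • F := by
    rw [← C_smul, ← C_smul, smul_comm]
  simp only [curveForm, Finset.smul_sum, h, smul_formL, PowerSeries.coeff_mul, Finset.sum_smul,
    smul_smul]
  rw [Finset.sum_sigma', Finset.sum_sigma']
  refine Finset.sum_nbij' (fun ⟨⟨u, _⟩, ⟨v, w⟩⟩ => ⟨(u + v, w), (u, v)⟩)
    (fun ⟨⟨_, w⟩, ⟨u, v⟩⟩ => ⟨(u, v + w), (v, w)⟩) ?_ ?_ ?_ ?_ ?_ <;>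
    simp only [Finset.mem_sigma, HasAntidiagonal.mem_antidiagonal, Sigma.forall, Prod.forall]
  · rintro u v w x ⟨rfl, rfl⟩
    exact ⟨add_assoc _ _ _, trivial⟩
  · rintro u v w x ⟨rfl, rfl⟩
    exact ⟨(add_assoc _ _ _).symm, trivial⟩
  · rintro u v w x ⟨rfl, rfl⟩
    rfl
  · rintro u v w x ⟨rfl, rfl⟩
    rfl
  · intros
    trivial

theorem curveForm_X_pow (i d : ℕ) :
    curveForm a ha (PowerSeries.X ^ i : PowerSeries k) (d + i) = formL k a ha d := by
  apply gamCoeff_ext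
  intro γ
  rw [gamCoeff_curveForm, gamCoeff_formL, PowerSeries.coeff_X_pow]
  split_ifs <;> first | rfl | omega

theorem curveForm_mul_X_pow (u : PowerSeries k) (i d : ℕ) :
    curveForm a ha (u * PowerSeries.X ^ i) (d + i) = curveForm a ha u d := by
  apply gamCoeff_ext
  intro γ
  rw [gamCoeff_curveForm, gamCoeff_curveForm, PowerSeries.coeff_mul_X_pow']
  split_ifs <;> first | rfl | omega | (congr 2; omega)

/-! ### Structure of the inverse system. -/

/-- Elements of the inverse system are linear combinations of the forms `L_{ω,j}`. -/
theorem exists_eq_curveForm {F : Gam k n} (hF : F ∈ inverseSystem (semigroupIdeal k a ha)) :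
    ∃ u d, F = curveForm a ha u d := by
  classical
  have hconst (α β : Fin n →₀ ℕ) (h : wdeg a α = wdeg a β) : gamCoeff α F = gamCoeff β F := by
    have hker : MvPowerSeries.monomial α (1 : k) - MvPowerSeries.monomial β 1 ∈
        semigroupIdeal k a ha := by
      refine (RingHom.mem_ker).mpr (PowerSeries.ext fun m => ?_)
      rw [coeff_curveMap]
      simp [MvPowerSeries.coeff_monomial, h]
    have := congrArg (gamCoeff 0) (hF _ hker)
    rwa [sub_smul, map_sub, gamCoeff_zero_monomial_smul, gamCoeff_zero_monomial_smul, map_zero,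
      sub_eq_zero] at this
  let d := (finite_setOf_gamCoeff_ne_zero F).toFinset.sup (wdeg a)
  have hd (γ) (h : d < wdeg a γ) : gamCoeff γ F = 0 := by
    by_contra hne
    exact absurd (Finset.le_sup (f := wdeg a) (by simpa using hne)) (not_le.mpr h)
  -- The value 0 off the semigroup is harmless, since `L_j = 0` there.
  let c : ℕ → k := fun j => if h : ∃ K, wdeg a K = j then gamCoeff h.choose F else 0
  have hc (γ) : c (wdeg a γ) = gamCoeff γ F := by
    have h : ∃ K, wdeg a K = wdeg a γ := ⟨γ, rfl⟩
    simp only [c, dif_pos h]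
    exact hconst _ _ h.choose_spec
  refine ⟨PowerSeries.mk fun p => c (d - p), d, gamCoeff_ext fun γ => ?_⟩
  rw [gamCoeff_curveForm, PowerSeries.coeff_mk]
  split_ifs with h
  · rw [Nat.sub_sub_self h, hc]
  · exact hd γ (not_le.mp h)

/-- Each factor `X` of `u` can be cancelled against one unit of `d`; at `d = 0` only `u_0 L_0`
remains, so `F ≠ 0` forces `u_0 ≠ 0`. -/
theorem exists_eq_curveForm_constantCoeff_ne_zero {F : Gam k n}
    (hF : F ∈ inverseSystem (semigroupIdeal k a ha)) (h0 : F ≠ 0) :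
    ∃ u d, PowerSeries.constantCoeff u ≠ 0 ∧ F = curveForm a ha u d := by
  obtain ⟨u, d, rfl⟩ := exists_eq_curveForm a ha hF
  clear hF
  induction d generalizing u with
  | zero =>
    refine ⟨u, 0, fun hu => h0 ?_, rfl⟩
    simp [curveForm, hu]
  | succ d ih =>
    by_cases hu : PowerSeries.constantCoeff u = 0
    · obtain ⟨v, rfl⟩ := PowerSeries.X_dvd_iff.mpr hu
      have h : curveForm a ha (PowerSeries.X * v) (d + 1) = curveForm a ha v d := by
        rw [mul_comm]
        simpa using curveForm_mul_X_pow a ha v 1 d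
      rw [h] at h0 ⊢
      exact ih v h0
    · exact ⟨u, d + 1, hu, rfl⟩

theorem formL_mem_inverseSystem (j : ℕ) :
    formL k a ha j ∈ inverseSystem (semigroupIdeal k a ha) := by
  intro g hg
  rw [smul_formL, show curveMap k a ha g = 0 from hg]
  simp [curveForm]

/-- With `i = D - d ≥ c`, the series `u X^i` has no terms below the conductor, so it lifts to `R`.
-/
theorem curveForm_eq_smul_formL {c : ℕ} (hc : ∀ m, c ≤ m → m ∈ degrees a) (u : PowerSeries k)
    {d D : ℕ} (hD : d + c ≤ D) :
    ∃ f : MvPowerSeries (Fin n) k, curveForm a ha u d = f • formL k a ha D := by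
  obtain ⟨i, rfl⟩ := Nat.exists_eq_add_of_le (show d ≤ D by omega)
  obtain ⟨f, hf⟩ := exists_curveMap_eq a ha (u * PowerSeries.X ^ i) fun m hm => by
    have : m < c := not_le.mp fun h => hm (hc m h)
    rw [PowerSeries.coeff_mul_X_pow', if_neg (by omega)]
  exact ⟨f, by rw [smul_formL, hf, curveForm_mul_X_pow]⟩

/-- A combination of the forms with leading form `L_{ω,d}` generates all forms of degree at
most `d` minus the conductor. -/
theorem formL_eq_smul_curveForm {c : ℕ} (hc : ∀ m, c ≤ m → m ∈ degrees a) {u : PowerSeries k}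
    (hu : PowerSeries.constantCoeff u ≠ 0) {l d : ℕ} (hd : l + c ≤ d) :
    ∃ f : MvPowerSeries (Fin n) k, formL k a ha l = f • curveForm a ha u d := by
  obtain ⟨i, rfl⟩ := Nat.exists_eq_add_of_le (show l ≤ d by omega)
  obtain ⟨f, hf⟩ := exists_curveMap_eq a ha (u⁻¹ * PowerSeries.X ^ i) fun m hm => by
    have : m < c := not_le.mp fun h => hm (hc m h)
    rw [PowerSeries.coeff_mul_X_pow', if_neg (by omega)]
  refine ⟨f, ?_⟩
  rw [smul_curveForm, hf, ← mul_assoc, PowerSeries.mul_inv_cancel _ hu, one_mul, curveForm_X_pow]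

/-! ### Almost finite generation. -/

theorem not_inverseSystem_le_span_formL {c : ℕ} (hc : ∀ m, c ≤ m → m ∈ degrees a) (D : ℕ) :
    ¬ inverseSystem (semigroupIdeal k a ha) ≤
      Submodule.span (MvPowerSeries (Fin n) k) {formL k a ha D} := by
  intro hle
  -- The degree `D + c + 1` exceeds `D`, out of reach of multiples of `L_D`, and is past the
  -- conductor, so its form is nonzero.
  obtain ⟨f, hf⟩ := Submodule.mem_span_singleton.mp
    (hle (formL_mem_inverseSystem a ha (D + c + 1)))
  obtain ⟨K, hK⟩ := hc (D + c + 1) (by omega)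
  have := congrArg (gamCoeff K) hf
  rw [gamCoeff_smul_formL, gamCoeff_formL, if_neg (by omega), if_pos hK] at this
  exact zero_ne_one this

/-- Finitely many generators would all lie in a single `⟨L_D⟩` with `D` large. -/
theorem inverseSystem_not_fg {c : ℕ} (hc : ∀ m, c ≤ m → m ∈ degrees a) :
    ¬ (inverseSystem (semigroupIdeal k a ha)).FG := by
  rintro ⟨G, hG⟩
  have h : ∀ x ∈ G, ∀ᶠ D in atTop,
      x ∈ Submodule.span (MvPowerSeries (Fin n) k) {formL k a ha D} := by
    intro x hx
    obtain ⟨u, d, rfl⟩ := exists_eq_curveForm a ha (hG ▸ Submodule.subset_span hx)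
    filter_upwards [eventually_ge_atTop (d + c)] with D hD
    obtain ⟨f, hf⟩ := curveForm_eq_smul_formL a ha hc u hD
    exact Submodule.mem_span_singleton.mpr ⟨f, hf.symm⟩
  obtain ⟨D, hD⟩ := ((Filter.eventually_all_finset G).mpr h).exists
  exact not_inverseSystem_le_span_formL a ha hc D (hG ▸ Submodule.span_le.mpr hD)

/-- Such an `N` omits some `L_l`, hence has no element of leading degree `≥ l + c`; it is therefore
finite-dimensional over `k`. -/
theorem fg_of_lt_inverseSystem {c : ℕ} (hc : ∀ m, c ≤ m → m ∈ degrees a)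
    {N : Submodule (MvPowerSeries (Fin n) k) (Gam k n)}
    (hN : N < inverseSystem (semigroupIdeal k a ha)) : N.FG := by
  have hl : ∃ l, formL k a ha l ∉ N := by
    by_contra! h
    refine hN.not_ge fun F hF => ?_
    obtain ⟨u, d, rfl⟩ := exists_eq_curveForm a ha hF
    obtain ⟨f, hf⟩ := curveForm_eq_smul_formL a ha hc u (le_refl (d + c))
    exact hf ▸ N.smul_mem f (h _)
  obtain ⟨l, hl⟩ := hl
  let V : Submodule k (Gam k n) := Submodule.span k (formL k a ha '' Set.Iio (l + c))
  have hV : FiniteDimensional k V :=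
    FiniteDimensional.span_of_finite k ((Set.finite_Iio (l + c)).image _)
  have hNV : N.restrictScalars k ≤ V := by
    intro F hF
    by_cases h0 : F = 0
    · exact h0 ▸ V.zero_mem
    obtain ⟨u, d, hu, rfl⟩ := exists_eq_curveForm_constantCoeff_ne_zero a ha (hN.le hF) h0
    have hd : d < l + c := by
      by_contra! hd
      obtain ⟨f, hf⟩ := formL_eq_smul_curveForm a ha hc hu hd
      exact hl (hf ▸ N.smul_mem f hF)
    refine V.sum_mem fun p hp => V.smul_mem _ (Submodule.subset_span ⟨p.2, ?_, rfl⟩)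
    rw [HasAntidiagonal.mem_antidiagonal] at hp
    exact Set.mem_Iio.mpr (by omega)
  have : FiniteDimensional k (N.restrictScalars k) := Submodule.finiteDimensional_of_le hNV
  exact Submodule.FG.of_restrictScalars k (Module.Finite.iff_fg.mp this)

end SemigroupInverseSystem

end

theorem theorem4p1 {k : Type*} [Field k] {n : ℕ} (a : Fin n → ℕ)
    (ha : ∀ i, 1 ≤ a i) (hmono : StrictMono a) (hgcd : Finset.univ.gcd a = 1) :
    (SemigroupInverseSystem.inverseSystem (SemigroupInverseSystem.semigroupIdeal k a ha) :
        Set (SemigroupInverseSystem.Gam k n)) =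
      ⋃ j ∈ SemigroupInverseSystem.degrees a,
        (Submodule.span (MvPowerSeries (Fin n) k)
          {SemigroupInverseSystem.formL k a ha j} : Set (SemigroupInverseSystem.Gam k n)) ∧
    SemigroupInverseSystem.AlmostFG (MvPowerSeries (Fin n) k)
      (SemigroupInverseSystem.inverseSystem (SemigroupInverseSystem.semigroupIdeal k a ha)) := by
  open SemigroupInverseSystem in
  obtain ⟨c, hc⟩ := eventually_mem_degrees a hgcd
  refine ⟨Set.Subset.antisymm (fun F hF => ?_) (Set.iUnion₂_subset fun j _ => ?_), ?_, ?_⟩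
  · obtain ⟨u, d, rfl⟩ := exists_eq_curveForm a ha hF
    obtain ⟨f, hf⟩ := curveForm_eq_smul_formL a ha hc u (le_refl (d + c))
    exact Set.mem_iUnion₂.mpr
      ⟨d + c, hc _ (Nat.le_add_left c d), Submodule.mem_span_singleton.mpr ⟨f, hf.symm⟩⟩
  · exact Submodule.span_le.mpr (Set.singleton_subset_iff.mpr (formL_mem_inverseSystem a ha j))
  · exact fun h => inverseSystem_not_fg a ha hc (Module.Finite.iff_fg.mp h)
  · intro N hN
    -- A submodule of the inverse system is viewed inside `Γ`, where it stays proper.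
    refine Submodule.fg_of_fg_map_injective (Submodule.subtype _) Subtype.val_injective
      (fg_of_lt_inverseSystem a ha hc (lt_of_le_of_ne (Submodule.map_subtype_le _ _) fun h => ?_))
    refine hN (Submodule.map_injective_of_injective (f := Submodule.subtype _)
      Subtype.val_injective ?_)
    rw [h, Submodule.map_top, Submodule.range_subtype]
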